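/- Let $\mathcal A=(A_1,\dots,A_r)$ be a finite family of (not necessarily distinct) subsets of a finite set $E$. A partial transversal of $\mathcal A$ is a set $X\subseteq E$ whose elements can be assigned pairwise distinct indices such that each $x\in X$ lies in the set $A_i$ of its index $i$. The family $\mathcal A$ is a presentation of a matroid $M$ on $E$ if the independent sets of $M$ are exactly the partial transversals of $\mathcal A$; matroids that have a presentation are called transversal. For $e\in E$, a graph $G$ is an $(e,\mathcal A)$-presenting graph if there is a bijection $\phi:V(G)\to\{i\in\{1,\dots,r\}: e\in A_i\}$ (an $(e,\mathcal A)$-presenting map of $G$) such that, for all distinct $v_1,v_2\in V(G)$, the subgraph of $G$ induced by $\{u\in V(G): A_{\phi(u)}\subseteq \mathrm{cl}^*_M(A_{\phi(v_1)}\cup A_{\phi(v_2)})\}$ is connected, where $\mathrm{cl}^*_M$ is the closure operator of the dual matroid $M^*$. It is a minimal $(e,\mathcal A)$-presenting graph if, moreover, deleting any single edge of $G$ yields a graph that is not $(e,\mathcal A)$-presenting. **Theorem.** Let $M$ be a transversal matroid on a finite ground set, and let $e\in E(M)$. Let $\mathcal A=(A_1,\dots,A_r)$ be a presentation of $M$ with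 $r=r(M)$, and let $0\le k\le r$ be such that $e\in A_i$ for all $i\le k$ and $e\notin A_j$ for all $j>k$. Let $G$ be a minimal $(e,\mathcal A)$-presenting graph which is a tree (if $k=0$, then $G$ has no vertices, and this is allowed), and let $\phi$ be any $(e,\mathcal A)$-presenting map of $G$. Let $\{u_1,v_1\},\dots,\{u_{k-1},v_{k-1}\}$ be the edges of $G$, each listed once (there are none if $k\le 1$). Then $$\bigl((A_{\phi(u_1)}\cup A_{\phi(v_1)})-e,\ \dots,\ (A_{\phi(u_{k-1})}\cup A_{\phi(v_{k-1})})-e,\ A_{k+1},\dots,A_r\bigr)$$ is a presentation of the contraction $M/e$. -/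

import Mathlib

/-- `X` is a partial transversal of the family `A`: its elements can be assigned distinct
indices `i` with `x ∈ A i`. -/
def IsPartialTransversal {α ι : Type*} (A : ι → Set α) (X : Set α) : Prop :=
  ∃ f : X → ι, Function.Injective f ∧ ∀ x : X, (x : α) ∈ A (f x)

/-- The family `A` of subsets of the ground set is a presentation of `M`: the independent sets of
`M` are exactly the partial transversals of `A`. The members of `A` need not be distinct. -/
def IsPresentation {α ι : Type*} (M : Matroid α) (A : ι → Set α) : Prop :=
  (∀ i, A i ⊆ M.E) ∧ ∀ X : Set α, M.Indep X ↔ IsPartialTransversal A X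

/-- `φ` is an `(e, A)`-presenting map of `G`, with closure taken in the dual `M✶`. -/
def IsPresentingMap {α ι V : Type*} (M : Matroid α) (e : α) (A : ι → Set α)
    (G : SimpleGraph V) (φ : V ≃ {i : ι // e ∈ A i}) : Prop :=
  ∀ v₁ v₂ : V, v₁ ≠ v₂ →
    (G.induce {u : V | A (φ u) ⊆ M✶.closure (A (φ v₁) ∪ A (φ v₂))}).Connected

/-- `G` is an `(e, A)`-presenting graph. -/
def IsPresentingGraph {α ι V : Type*} (M : Matroid α) (e : α) (A : ι → Set α)
    (G : SimpleGraph V) : Prop :=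
  ∃ φ : V ≃ {i : ι // e ∈ A i}, IsPresentingMap M e A G φ

/-- `G` is a minimal `(e, A)`-presenting graph: deleting any one edge destroys the property. -/
def IsMinimalPresentingGraph {α ι V : Type*} (M : Matroid α) (e : α) (A : ι → Set α)
    (G : SimpleGraph V) : Prop :=
  IsPresentingGraph M e A G ∧
    ∀ d ∈ G.edgeSet, ¬ IsPresentingGraph M e A (G.deleteEdges {d})

/-! For `e` not a loop, `X` is independent in `M ／ {e}` iff `e ∉ X` and `insert e X` is a partial
transversal of `A`. Given such a transversal, root the tree at the vertex whose set is matched to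
`e`; an element matched to any other vertex moves to the edge towards the root
(`isPartialTransversal_contract`). Conversely, let `X` be a transversal of the new family and
suppose `insert e X` contains a circuit `C`. By Hall's theorem fewer than `|C|` sets `A i` meet `C`.
By orthogonality of circuits and cocircuits, the vertices whose sets avoid `C` form a connected
subgraph; if there are `t ≥ 1` of them, at least `t - 1` edge sets avoid `C`. So at most as many new
sets as old ones meet `C`, too few to match `C`. The case `e ∈ C` is a direct count. -/

/-! ### Counting edges of connected graphs -/

/-- In a connected graph, every vertex other than a given root can be assigned an incident edge,
with distinct vertices receiving distinct edges. -/
theorem SimpleGraph.Connected.exists_injective_incident_edge {V : Type*} {G : SimpleGraph V}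
    (hG : G.Connected) (root : V) :
    ∃ f : {v : V // v ≠ root} → G.edgeSet, Function.Injective f ∧ ∀ v, (v : V) ∈ (f v : Sym2 V) := by
  have parent : ∀ v : {v : V // v ≠ root},
      ∃ p, G.Adj v p ∧ G.dist v root = G.dist p root + 1 := by
    rintro ⟨v, hv⟩
    obtain ⟨w, hw⟩ := hG.exists_walk_length_eq_dist v root
    cases w with
    | nil => exact absurd rfl hv
    | @cons _ p _ hadj q =>
      refine ⟨p, hadj, ?_⟩
      have h₁ := SimpleGraph.dist_le q
      have h₂ := hG.dist_triangle (u := v) (v := p) (w := root)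
      rw [SimpleGraph.dist_eq_one_iff_adj.2 hadj] at h₂
      simp only [SimpleGraph.Walk.length_cons] at hw
      change G.dist v root = _
      omega
  choose p hadj hdist using parent
  refine ⟨fun v => ⟨s(v, p v), hadj v⟩, fun v w h => ?_, fun v => Sym2.mem_mk_left _ _⟩
  have h' : s((v : V), p v) = s((w : V), p w) := congrArg Subtype.val h
  rcases Sym2.eq_iff.1 h' with ⟨h₁, -⟩ | ⟨h₁, h₂⟩
  · exact Subtype.ext h₁
  -- Otherwise each vertex would be the other's parent, hence strictly closer to the root than the
  -- other.
  · have h₃ := hdist v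
    have h₄ := hdist w
    rw [h₂] at h₃
    rw [← h₁] at h₄
    omega

/-- A connected induced subgraph on `n` vertices contains at least `n - 1` of the listed edges. -/
theorem SimpleGraph.ncard_le_ncard_edges_add_one {V ι : Type*} [Finite ι] {G : SimpleGraph V}
    {u v : ι → V} (huv : Set.SurjOn (fun i => s(u i, v i)) Set.univ G.edgeSet)
    {T : Set V} (hT : T.Nonempty → (G.induce T).Connected) :
    T.ncard ≤ {i | u i ∈ T ∧ v i ∈ T}.ncard + 1 := by
  rcases T.eq_empty_or_nonempty with rfl | hne
  · simp
  obtain ⟨root, hroot⟩ := hne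
  obtain ⟨f, hf, -⟩ := (hT ⟨root, hroot⟩).exists_injective_incident_edge ⟨root, hroot⟩
  have key : ∀ x : {x : T // x ≠ ⟨root, hroot⟩},
      ∃ i, s(u i, v i) = Sym2.map Subtype.val (f x : Sym2 T) := by
    intro x
    have hx : Sym2.map Subtype.val (f x : Sym2 T) ∈ G.edgeSet := by
      have := (f x).2
      revert this
      generalize (f x : Sym2 T) = d
      induction d with | _ a b => exact fun h => h
    obtain ⟨i, -, hi⟩ := huv hx
    exact ⟨i, hi⟩
  choose g hg using key
  have hmem : ∀ x, u (g x) ∈ T ∧ v (g x) ∈ T := by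
    intro x
    have h : ∀ y, y ∈ s(u (g x), v (g x)) → y ∈ T := by
      intro y hy
      rw [hg x, Sym2.mem_map] at hy
      obtain ⟨z, -, rfl⟩ := hy
      exact z.2
    exact ⟨h _ (Sym2.mem_mk_left _ _), h _ (Sym2.mem_mk_right _ _)⟩
  have hinj : Function.Injective g := by
    intro x y hxy
    have h := hg x
    rw [hxy, hg y] at h
    exact (hf (Subtype.ext (Sym2.map.injective Subtype.val_injective h))).symm
  have hcard : Nat.card {x : T // x ≠ ⟨root, hroot⟩} ≤ {i | u i ∈ T ∧ v i ∈ T}.ncard :=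
    Nat.card_le_card_of_injective
      (fun x => (⟨g x, hmem x⟩ : {i | u i ∈ T ∧ v i ∈ T}))
      fun x y h => hinj (congrArg Subtype.val h)
  have hsub : T.ncard - 1 ≤ Nat.card {x : T // x ≠ ⟨root, hroot⟩} := by
    have h : ({⟨root, hroot⟩}ᶜ : Set T).ncard = Nat.card {x : T // x ≠ ⟨root, hroot⟩} := rfl
    rw [← h]
    -- `T` is finite because its non-root vertices inject into the edge indices.
    have : Finite {x : T // x ≠ ⟨root, hroot⟩} := Finite.of_injective g hinj
    have h₁ := Set.ncard_add_ncard_compl ({⟨root, hroot⟩} : Set T) (Set.finite_singleton _) ‹_›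
    rw [Set.ncard_singleton] at h₁
    change Nat.card T - 1 ≤ _
    omega
  omega

/-! ### Circuits, dual closure and Hall's condition -/

/-- The dual closure of a set avoiding a circuit avoids that circuit. -/
theorem Matroid.IsCircuit.disjoint_dual_closure {α : Type*} {M : Matroid α} {C X : Set α}
    (hC : M.IsCircuit C) (hX : Disjoint X C) : Disjoint (M✶.closure X) C := by
  rw [Set.disjoint_left] at hX ⊢
  intro x hx hxC
  have hxX : x ∉ X := fun h => hX h hxC
  obtain ⟨D, hDX, hD, hxD⟩ := (M✶.mem_closure_iff_exists_isCircuit hxX).1 hx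
  -- The cocircuit `D ⊆ insert x X` would meet `C` in `x` alone, against orthogonality.
  refine hC.inter_isCocircuit_ne_singleton (e := x) hD (Set.Subset.antisymm ?_ ?_)
  · rintro y ⟨hyC, hyD⟩
    rcases hDX hyD with rfl | hy
    · rfl
    · exact absurd hyC (hX hy)
  · rintro y rfl
    exact ⟨hxC, hxD⟩

theorem IsPartialTransversal.subset {α ι : Type*} {A : ι → Set α} {X Y : Set α}
    (hX : IsPartialTransversal A X) (hYX : Y ⊆ X) : IsPartialTransversal A Y := by
  obtain ⟨f, hf, hfA⟩ := hX
  exact ⟨fun y => f ⟨y, hYX y.2⟩,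
    fun a b h => Subtype.ext (congrArg (fun z : X => (z : α)) (hf h)), fun y => hfA _⟩

/-- Hall's condition fails on a circuit of a transversal matroid. -/
theorem IsPresentation.ncard_lt_of_isCircuit {α ι : Type*} [Finite ι] {M : Matroid α}
    {A : ι → Set α} (hA : IsPresentation M A) {C : Set α} (hC : M.IsCircuit C) :
    {i | ¬ Disjoint (A i) C}.ncard < C.ncard := by
  classical
  have := Fintype.ofFinite ι
  have hnot : ¬ ∃ f : C → ι, Function.Injective f ∧ ∀ x : C, (x : α) ∈ A (f x) :=
    fun h => hC.not_indep ((hA.2 C).2 h)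
  rw [← Fintype.all_card_le_filter_rel_iff_exists_injective
    (fun (x : C) i => (x : α) ∈ A i)] at hnot
  push Not at hnot
  obtain ⟨Y, hY⟩ := hnot
  -- A proper subset of `C` is independent, so it cannot violate Hall's condition: the violator is
  -- all of `C`.
  have hYC : Subtype.val '' (Y : Set C) = C := by
    refine hC.eq_of_not_indep_subset (fun hI => ?_) (by rintro _ ⟨x, -, rfl⟩; exact x.2)
    obtain ⟨f, hf, hfA⟩ := (hA.2 _).1 hI
    refine hY.not_ge ?_
    rw [← Y.card_attach]
    refine Finset.card_le_card_of_injOn (fun y => f ⟨y, y, y.2, rfl⟩) ?_ ?_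
    · intro y _
      simp only [Finset.coe_filter, Finset.mem_univ, true_and]
      exact ⟨y, y.2, hfA _⟩
    · intro y _ z _ h
      exact Subtype.ext (Subtype.ext
        (congrArg (fun w : (Subtype.val '' (Y : Set C) : Set α) => (w : α)) (hf h)))
  have h₁ : C.ncard = Y.card := by
    rw [← Set.ncard_coe_finset, ← Set.ncard_image_of_injective _ Subtype.val_injective, hYC]
  rw [h₁]
  refine lt_of_eq_of_lt ?_ hY
  rw [← Set.ncard_coe_finset]
  congr 1
  ext i
  simp only [Set.mem_ofPred_eq, Finset.coe_filter, Finset.mem_univ, true_and,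
    Set.not_disjoint_iff]
  constructor
  · rintro ⟨x, hxi, hxC⟩
    rw [← hYC] at hxC
    obtain ⟨y, hy, rfl⟩ := hxC
    exact ⟨y, hy, hxi⟩
  · rintro ⟨y, -, hyi⟩
    exact ⟨y, hyi, y.2⟩

/-- The vertices whose sets avoid a given circuit span a connected subgraph of any presenting
graph. -/
theorem IsPresentingMap.induce_connected {α ι V : Type*} {M : Matroid α} {e : α} {A : ι → Set α}
    {G : SimpleGraph V} {φ : V ≃ {i : ι // e ∈ A i}} (hφ : IsPresentingMap M e A G φ)
    (hA : ∀ i, A i ⊆ M.E) {C : Set α} (hC : M.IsCircuit C)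
    (hne : {v | Disjoint (A (φ v)) C}.Nonempty) :
    (G.induce {v | Disjoint (A (φ v)) C}).Connected := by
  have : Nonempty {v | Disjoint (A (φ v)) C} := hne.to_subtype
  refine ⟨fun a b => ?_⟩
  by_cases hab : a = b
  · rw [hab]
  have hconn := hφ a b fun h => hab (Subtype.ext h)
  have hsub : {w | A (φ w) ⊆ M✶.closure (A (φ a) ∪ A (φ b))} ⊆ {v | Disjoint (A (φ v)) C} :=
    fun w hw => (hC.disjoint_dual_closure (a.2.union_left b.2)).mono_left hw
  have hground : A (φ a) ∪ A (φ b) ⊆ M✶.E := Set.union_subset (hA _) (hA _)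
  have hcl := M✶.subset_closure _ hground
  exact (hconn.preconnected ⟨a, Set.subset_union_left.trans hcl⟩
    ⟨b, Set.subset_union_right.trans hcl⟩).map (G.induceHomOfLE hsub).toHom

/-- The sets of the family, split into those containing `e` and the others. -/
theorem ncard_not_disjoint_eq {α V : Type*} [Finite V] {e : α} {r k : ℕ} {A : Fin r → Set α}
    (hk : ∀ i : Fin r, e ∈ A i ↔ (i : ℕ) < k) (φ : V ≃ {i : Fin r // e ∈ A i}) (C : Set α) :
    {i | ¬ Disjoint (A i) C}.ncard = {v | Disjoint (A (φ v)) C}ᶜ.ncard +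
      {j : {j : Fin r // k ≤ (j : ℕ)} | ¬ Disjoint (A j) C}.ncard := by
  have h₁ : ((fun v => (φ v : Fin r)) '' {v | Disjoint (A (φ v)) C}ᶜ).ncard =
      {v | Disjoint (A (φ v)) C}ᶜ.ncard :=
    Set.ncard_image_of_injective _ (Subtype.val_injective.comp φ.injective)
  have h₂ : (Subtype.val '' {j : {j : Fin r // k ≤ (j : ℕ)} | ¬ Disjoint (A j) C}).ncard =
      {j : {j : Fin r // k ≤ (j : ℕ)} | ¬ Disjoint (A j) C}.ncard :=
    Set.ncard_image_of_injective _ Subtype.val_injective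
  rw [← h₁, ← h₂, ← Set.ncard_union_eq]
  · congr 1
    ext i
    constructor
    · intro hi
      by_cases hik : e ∈ A i
      · left
        refine ⟨φ.symm ⟨i, hik⟩, ?_, ?_⟩
        · simpa using hi
        · simp
      · right
        exact ⟨⟨i, not_lt.1 fun h => hik ((hk i).2 h)⟩, hi, rfl⟩
    · rintro (⟨v, hv, rfl⟩ | ⟨j, hj, rfl⟩)
      · exact hv
      · exact hj
  · rw [Set.disjoint_left]
    rintro _ ⟨v, -, rfl⟩ ⟨j, -, hj⟩
    have h₃ := (hk _).1 (φ v).2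
    have h₄ := j.2
    rw [hj] at h₄
    exact absurd h₃ (not_lt.2 h₄)

/-! ### The two directions of the equivalence -/

/-- Contracting along the tree edges turns a transversal through `e` into one avoiding `e`. -/
theorem isPartialTransversal_contract {α V : Type*} {e : α} {r k : ℕ} {A : Fin r → Set α}
    (hk : ∀ i : Fin r, e ∈ A i ↔ (i : ℕ) < k) {G : SimpleGraph V} (hG : G.Connected)
    (φ : V ≃ {i : Fin r // e ∈ A i}) {u v : Fin (k - 1) → V}
    (huv : Set.SurjOn (fun i => s(u i, v i)) Set.univ G.edgeSet)
    {X : Set α} (heX : e ∉ X) (hX : IsPartialTransversal A (insert e X)) :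
    IsPartialTransversal
      (Sum.elim
        (fun i : Fin (k - 1) => ((A (φ (u i)) : Set α) ∪ A (φ (v i))) \ {e})
        (fun j : {j : Fin r // k ≤ (j : ℕ)} => A j)) X := by
  obtain ⟨f, hf, hfA⟩ := hX
  set e' : (insert e X : Set α) := ⟨e, Set.mem_insert _ _⟩ with he'
  set root : V := φ.symm ⟨f e', hfA e'⟩ with hroot
  obtain ⟨g, hg, hgmem⟩ := hG.exists_injective_incident_edge root
  have key : ∀ x : {x : V // x ≠ root}, ∃ i, s(u i, v i) = (g x : Sym2 V) := fun x => by
    obtain ⟨i, -, hi⟩ := huv (g x).2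
    exact ⟨i, hi⟩
  choose c hc using key
  have hcinj : Function.Injective c := fun x y hxy => by
    have h := hc x
    rw [hxy, hc y] at h
    exact (hg (Subtype.ext h)).symm
  let ins : X → (insert e X : Set α) := fun x => ⟨x, Set.mem_insert_of_mem _ x.2⟩
  have hins : Function.Injective ins :=
    fun x y h => Subtype.ext (congrArg (fun z : (insert e X : Set α) => (z : α)) h)
  have hnr : ∀ (x : X) (h : e ∈ A (f (ins x))), φ.symm ⟨f (ins x), h⟩ ≠ root := by
    intro x h heq
    have h₁ := congrArg Subtype.val (φ.symm.injective heq)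
    have h₂ : ((ins x : (insert e X : Set α)) : α) = e := congrArg Subtype.val (hf h₁)
    exact heX (h₂ ▸ x.2)
  have hkle : ∀ i : Fin r, e ∉ A i → k ≤ (i : ℕ) := fun i h => not_lt.1 fun h' => h ((hk i).2 h')
  classical
  refine ⟨fun x => if h : e ∈ A (f (ins x)) then Sum.inl (c ⟨_, hnr x h⟩)
    else Sum.inr ⟨f (ins x), hkle _ h⟩, fun x y hxy => ?_, fun x => ?_⟩
  · apply hins
    apply hf
    by_cases hx : e ∈ A (f (ins x)) <;> by_cases hy : e ∈ A (f (ins y)) <;>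
      simp only [hx, hy, dif_pos, dif_neg, not_false_eq_true, Sum.inl.injEq, Sum.inr.injEq,
        reduceCtorEq] at hxy
    · have h₁ := congrArg Subtype.val (hcinj hxy)
      exact congrArg Subtype.val (φ.symm.injective h₁)
    · exact congrArg Subtype.val hxy
  · have hxA : (x : α) ∈ A (f (ins x)) := hfA (ins x)
    have hxe : (x : α) ≠ e := fun h => heX (h ▸ x.2)
    by_cases hx : e ∈ A (f (ins x))
    · simp only [hx, dif_pos, Sum.elim_inl]
      refine ⟨?_, hxe⟩
      have hmem := hgmem ⟨_, hnr x hx⟩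
      rw [← hc, Sym2.mem_iff] at hmem
      rcases hmem with h | h
      · left
        rw [← h, Equiv.apply_symm_apply]
        exact hxA
      · right
        rw [← h, Equiv.apply_symm_apply]
        exact hxA
    · simp only [hx, dif_neg, not_false_eq_true, Sum.elim_inr]
      exact hxA

/-- A partial transversal of the contracted family stays independent when `e` is added. -/
theorem indep_insert_of_isPartialTransversal {α V : Type*} {M : Matroid α} [M.Finite] {e : α}
    (he : e ∈ M.E) {r k : ℕ} (hkpos : 0 < k) {A : Fin r → Set α} (hA : IsPresentation M A)
    (hk : ∀ i : Fin r, e ∈ A i ↔ (i : ℕ) < k) {G : SimpleGraph V}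
    {φ : V ≃ {i : Fin r // e ∈ A i}} (hV : Nat.card V = k) (hφ : IsPresentingMap M e A G φ)
    {u v : Fin (k - 1) → V}
    (huv : Set.SurjOn (fun i => s(u i, v i)) Set.univ G.edgeSet) {X : Set α}
    (hXE : X ⊆ M.E)
    (hX : IsPartialTransversal
      (Sum.elim
        (fun i : Fin (k - 1) => ((A (φ (u i)) : Set α) ∪ A (φ (v i))) \ {e})
        (fun j : {j : Fin r // k ≤ (j : ℕ)} => A j)) X) :
    M.Indep (insert e X) := by
  by_contra hI
  obtain ⟨C, hCX, hC⟩ := ((Matroid.not_indep_iff (Set.insert_subset he hXE)).1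
    hI).exists_isCircuit_subset
  have hCfin : C.Finite := M.ground_finite.subset hC.subset_ground
  have : Finite V := Finite.of_equiv _ φ.symm
  have hlt := hA.ncard_lt_of_isCircuit hC
  rw [ncard_not_disjoint_eq hk φ C] at hlt
  set T : Set V := {v | Disjoint (A (φ v)) C} with hTdef
  have hTcard := Set.ncard_add_ncard_compl T
  rw [hV] at hTcard
  set N : Set (Fin (k - 1)) := {i | u i ∈ T ∧ v i ∈ T} with hN
  have hNcard := Set.ncard_add_ncard_compl N
  rw [Nat.card_fin] at hNcard
  have hDX : C \ {e} ⊆ X := fun x hx => (hCX hx.1).resolve_left hx.2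
  have hD : (C \ {e}).ncard ≤ Nᶜ.ncard +
      {j : {j : Fin r // k ≤ (j : ℕ)} | ¬ Disjoint (A j) C}.ncard := by
    obtain ⟨f, hf, hfA⟩ := hX.subset hDX
    have himg : Set.range f ⊆ Sum.inl '' Nᶜ ∪
        Sum.inr '' {j : {j : Fin r // k ≤ (j : ℕ)} | ¬ Disjoint (A j) C} := by
      rintro _ ⟨x, rfl⟩
      have hx := hfA x
      rcases hfx : f x with i | j <;> rw [hfx] at hx
      · left
        refine ⟨i, fun hi => ?_, rfl⟩
        rcases hx.1 with h | h
        · exact Set.disjoint_left.1 hi.1 h x.2.1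
        · exact Set.disjoint_left.1 hi.2 h x.2.1
      · right
        exact ⟨j, Set.not_disjoint_iff.2 ⟨x, hx, x.2.1⟩, rfl⟩
    calc (C \ {e}).ncard = (Set.range f).ncard := by
          rw [← Set.image_univ, Set.ncard_image_of_injective _ hf, Set.ncard_univ]; rfl
      _ ≤ _ := Set.ncard_le_ncard himg
      _ ≤ _ := Set.ncard_union_le _ _
      _ = _ := by rw [Set.ncard_image_of_injective _ Sum.inl_injective,
          Set.ncard_image_of_injective _ Sum.inr_injective]
  by_cases heC : e ∈ C
  -- All `k` sets through `e` meet `C`. Replacing them by `k - 1` edge sets loses one set, exactly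
  -- as `C \ {e}` loses one element, so the Hall deficiency persists.
  · have hT : T = ∅ := Set.eq_empty_iff_forall_notMem.2 fun w hw =>
      Set.disjoint_left.1 hw (φ w).2 heC
    have h₀ := Set.ncard_sdiff_singleton_add_one heC hCfin
    rw [hT, Set.ncard_empty] at hTcard
    rw [hT] at hlt
    omega
  · rw [Set.sdiff_singleton_eq_self heC] at hD
    have h₀ : T.ncard ≤ N.ncard + 1 := SimpleGraph.ncard_le_ncard_edges_add_one huv (hφ.induce_connected hA.1 hC)
    -- `|C| ≤ (k - 1 - |N|) + m ≤ (k - |T|) + m < |C|`, where `m` counts the sets without `e` that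
    -- meet `C`.
    omega

open scoped Matroid in
theorem theorem2 {α V : Type*} (M : Matroid α) [M.Finite] (e : α) (he : e ∈ M.E)
    (r k : ℕ) (hkr : k ≤ r) (hr : M.eRank = (r : ℕ∞))
    (A : Fin r → Set α) (hA : IsPresentation M A)
    (hk : ∀ i : Fin r, e ∈ A i ↔ (i : ℕ) < k)
    (G : SimpleGraph V) (hG : IsMinimalPresentingGraph M e A G)
    -- the graph without vertices, which occurs for `k = 0`, is allowed too
    (hT : G.IsTree ∨ IsEmpty V)
    (φ : V ≃ {i : Fin r // e ∈ A i}) (hφ : IsPresentingMap M e A G φ)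
    -- the edges of `G`, each listed once
    (u v : Fin (k - 1) → V)
    (huv : Set.BijOn (fun i => s(u i, v i)) Set.univ G.edgeSet) :
    IsPresentation (M ／ {e})
      (Sum.elim
        (fun i : Fin (k - 1) => ((A (φ (u i)) : Set α) ∪ A (φ (v i))) \ {e})
        (fun j : {j : Fin r // k ≤ (j : ℕ)} => A j)) := by
  have hground : ∀ s, Sum.elim
        (fun i : Fin (k - 1) => ((A (φ (u i)) : Set α) ∪ A (φ (v i))) \ {e})
        (fun j : {j : Fin r // k ≤ (j : ℕ)} => A j) s ⊆ (M ／ {e}).E := by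
    rw [Matroid.contract_ground]
    rintro (i | j)
    · exact Set.sdiff_subset_sdiff_left (Set.union_subset (hA.1 _) (hA.1 _))
    · refine fun x hx => ⟨hA.1 _ hx, ?_⟩
      rintro rfl
      exact absurd ((hk _).1 hx) (not_lt.2 j.2)
  have hsub : ∀ X, IsPartialTransversal (Sum.elim
        (fun i : Fin (k - 1) => ((A (φ (u i)) : Set α) ∪ A (φ (v i))) \ {e})
        (fun j : {j : Fin r // k ≤ (j : ℕ)} => A j)) X → X ⊆ M.E \ {e} := by
    rintro X ⟨f, -, hfA⟩ x hx
    exact hground _ (hfA ⟨x, hx⟩)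
  refine ⟨hground, fun X => ?_⟩
  rcases Nat.eq_zero_or_pos k with rfl | hkpos
  -- For `k = 0`, `e` is a loop, so contracting it is deleting it; `Fin (0 - 1)` is empty by
  -- truncated subtraction.
  · have hloop : ¬ M.Indep {e} := fun h => by
      obtain ⟨f, -, hf⟩ := (hA.2 _).1 h
      exact absurd ((hk _).1 (hf ⟨e, rfl⟩)) (Nat.not_lt_zero _)
    rw [Matroid.indep_singleton, Matroid.not_isNonloop_iff he] at hloop
    rw [Matroid.contract_eq_delete_of_subset_loops (Set.singleton_subset_iff.2 hloop),
      Matroid.delete_indep_iff, hA.2, Set.disjoint_singleton_right]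
    constructor
    · rintro ⟨⟨f, hf, hfA⟩, -⟩
      exact ⟨fun x => Sum.inr ⟨f x, Nat.zero_le _⟩,
        fun x y h => hf (congrArg Subtype.val (Sum.inr_injective h)), hfA⟩
    · intro hX
      refine ⟨?_, fun h => (hsub X hX h).2 rfl⟩
      obtain ⟨f, hf, hfA⟩ := hX
      have hr' : ∀ x, ∃ j, f x = Sum.inr j := fun x => by
        rcases f x with i | j
        · exact i.elim0
        · exact ⟨j, rfl⟩
      choose g hg using hr'
      refine ⟨fun x => g x, fun x y h => hf ?_, fun x => ?_⟩
      · rw [hg, hg, Subtype.ext h]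
      · have h := hfA x
        rwa [hg] at h
  · have hV : Nat.card V = k := by
      rw [Nat.card_congr (φ.trans ((Equiv.subtypeEquivRight hk).trans (Fin.castLEquiv hkr).symm)),
        Nat.card_fin]
    have hG' : G.Connected := by
      refine (hT.resolve_right fun h => ?_).connected
      rw [Nat.card_of_isEmpty] at hV
      omega
    have hnonloop : M.IsNonloop e := by
      rw [← Matroid.indep_singleton, hA.2]
      exact ⟨fun _ => ⟨0, hkpos.trans_le hkr⟩, fun x y _ => Subsingleton.elim x y,
        by rintro ⟨_, rfl⟩; exact (hk _).2 hkpos⟩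
    rw [hnonloop.contractElem_indep_iff]
    constructor
    · rintro ⟨heX, hX⟩
      exact isPartialTransversal_contract hk hG' φ huv.surjOn heX ((hA.2 _).1 hX)
    · intro hX
      exact ⟨fun h => (hsub X hX h).2 rfl, indep_insert_of_isPartialTransversal he hkpos hA hk hV hφ
        huv.surjOn ((hsub X hX).trans Set.sdiff_subset) hX⟩
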